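/- **Proposition 2.1.** Let $V$ be a real vector space of dimension $m<\infty$, $\langle\cdot,\cdot\rangle_1$ a nondegenerate symmetric bilinear form on $V$ of signature $(-,+,\dots,+)$, $|v|_1:=\sqrt{|\langle v,v\rangle_1|}$, and fix a time-orientation, a norm $\|\cdot\|$ on $V$, a co-compact lattice $\Gamma\subseteq V$ and a smooth $\Gamma$-invariant function $f\colon V\to(0,\infty)$. Let $\overline g:=f^2\langle\cdot,\cdot\rangle_1$ and let $g$ be the induced Lorentzian metric on the torus $V/\Gamma$. Let $\mathfrak T$ be the set of future pointing causal vectors, i.e. of the $v\neq 0$ with $\langle v,v\rangle_1\le 0$ that are positively time-oriented, and for $\varepsilon>0$ put $$\mathfrak T_\varepsilon:=\{v\in\mathfrak T \mid \operatorname{dist}(v,\partial\mathfrak T)\ge\varepsilon\|v\|\},$$ the distance being taken with respect to $\|\cdot\|$. Causal curves are future pointing: they are locally absolutely continuous with velocity in $\mathfrak T$ almost everywhere. Let $L^g$ and $L^{\overline g}$ denote Lorentzian length, and let $d(x,y)$ be the time separation of $(V,\overline g)$, i.e. the supremum of the $\overline g$-lengths of the causal curves from $x$ to $y$ ($0$ if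 there are none). For a curve $\gamma\colon I\to V/\Gamma$ on an interval $I\subseteq\mathbb R$ put $\gamma(t)-\gamma(s):=\overline\gamma(t)-\overline\gamma(s)$, where $\overline\gamma\colon I\to V$ is any lift of $\gamma$. A causal curve $\gamma\colon I\to V/\Gamma$ is *$(G,\varepsilon)$-timelike* if there are $a,b\in I$ with $\gamma(b)-\gamma(a)\in\mathfrak T_\varepsilon$ and $\|\gamma(b)-\gamma(a)\|\ge G$; it is *$F$-almost maximal* if $L^g(\gamma|_{[s,t]})\ge d(\overline\gamma(s),\overline\gamma(t))-F$ for all $[s,t]\subseteq I$. Then for every $\varepsilon>0$, every $F<\infty$ and every $G_0>0$ there are constants $\delta>0$ and $0<K<\infty$ such that for all $G\in[G_0,\infty)$, all intervals $I$, all $F$-almost maximal $(G,\varepsilon)$-timelike curves $\gamma\colon I\to V/\Gamma$ and all $s<t$ in $I$ with $\|\gamma(t)-\gamma(s)\|\ge K$ we have $$\gamma(t)-\gamma(s)\in\mathfrak T_\delta .$$ -/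

import Mathlib

open MeasureTheory Set
open scoped ENNReal ContDiff

noncomputable section

namespace ConfTorus

variable {V : Type*} [NormedAddCommGroup V] [NormedSpace ℝ V]

/-- `B` is a nondegenerate symmetric bilinear form of signature `(-,+,…,+)`: it has an
orthonormal basis whose first vector has square `-1` and whose other vectors have square `1`. -/
def IsLorentzForm (B : LinearMap.BilinForm ℝ V) : Prop :=
  ∃ (n : ℕ) (b : Module.Basis (Fin (n + 1)) ℝ V), ∀ i j,
    B (b i) (b j) = if i = j then (if i = 0 then -1 else 1) else 0

/-- The cone of future pointing causal vectors. The time-orientation is given by a timelike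
vector `e`; a causal vector `v ≠ 0` is future pointing iff `B e v < 0`. The zero vector is
excluded. -/
def futureCone (B : LinearMap.BilinForm ℝ V) (e : V) : Set V :=
  {v | v ≠ 0 ∧ B v v ≤ 0 ∧ B e v < 0}

/-- The strict subcone of those future pointing causal `v` whose distance to the topological
boundary of the cone is at least `ε * ‖v‖`. -/
def strictCone (B : LinearMap.BilinForm ℝ V) (e : V) (ε : ℝ) : Set V :=
  {v | v ∈ futureCone B e ∧ ε * ‖v‖ ≤ Metric.infDist v (frontier (futureCone B e))}

/-- The conformally flat Lorentzian metric `f² B` at the point `x`. -/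
def metric (B : LinearMap.BilinForm ℝ V) (f : V → ℝ) (x v w : V) : ℝ :=
  f x ^ 2 * B v w

/-- A future pointing causal curve in `V` on the interval `I`: locally absolutely continuous, with
future pointing causal velocity almost everywhere. -/
def IsFutureCausal (B : LinearMap.BilinForm ℝ V) (e : V) (c : ℝ → V) (I : Set ℝ) : Prop :=
  (∀ s ∈ I, ∀ t ∈ I, AbsolutelyContinuousOnInterval c s t) ∧
    ∀ᵐ t ∂(volume.restrict I), deriv c t ∈ futureCone B e

/-- Length of `c` restricted to `[s,t]` with respect to the metric `f² B`. -/
def curveLength (B : LinearMap.BilinForm ℝ V) (f : V → ℝ) (c : ℝ → V) (s t : ℝ) : ℝ≥0∞ :=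
  ∫⁻ τ in Icc s t, ENNReal.ofReal (Real.sqrt |metric B f (c τ) (deriv c τ) (deriv c τ)|)

/-- Time separation (Lorentzian distance) of `(V, f² B)`: the supremum of the lengths of the
future pointing causal curves from `x` to `y`; it is `0` if there are none. -/
def timeSep (B : LinearMap.BilinForm ℝ V) (e : V) (f : V → ℝ) (x y : V) : ℝ≥0∞ :=
  ⨆ (a : ℝ) (b : ℝ) (c : ℝ → V) (_ : a ≤ b) (_ : IsFutureCausal B e c (Icc a b))
    (_ : c a = x) (_ : c b = y), curveLength B f c a b

/-- `c` is a lift to `V` of the curve `γ` in the torus `V ⧸ Γ`, on the interval `I`. -/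
def IsLift (Γ : Submodule ℤ V) (γ : ℝ → V ⧸ Γ) (I : Set ℝ) (c : ℝ → V) : Prop :=
  ContinuousOn c I ∧ ∀ t ∈ I, Submodule.Quotient.mk (c t) = γ t

/-- A future pointing causal curve in the torus: one (hence every) lift is future pointing
causal. -/
def IsCausalCurve (B : LinearMap.BilinForm ℝ V) (e : V) (Γ : Submodule ℤ V)
    (γ : ℝ → V ⧸ Γ) (I : Set ℝ) : Prop :=
  ∃ c, IsLift Γ γ I c ∧ IsFutureCausal B e c I

/-- `(G, ε)`-timelike causal curves: some displacement (computed in one, hence every, lift) lies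
in the strict subcone for `ε` and has norm at least `G`. -/
def IsTimelikeCurve (B : LinearMap.BilinForm ℝ V) (e : V) (Γ : Submodule ℤ V) (G ε : ℝ)
    (γ : ℝ → V ⧸ Γ) (I : Set ℝ) : Prop :=
  IsCausalCurve B e Γ γ I ∧
    ∃ c, IsLift Γ γ I c ∧ ∃ a ∈ I, ∃ b ∈ I, c b - c a ∈ strictCone B e ε ∧ G ≤ ‖c b - c a‖

/-- `F`-almost maximal causal curves: `L(γ|[s,t]) ≥ d(c s, c t) - F` for all `[s,t] ⊆ I`, where `c`
is one (hence every) lift; the projection `V → V ⧸ Γ` is a local isometry, so the length of `γ`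
is that of `c`. -/
def IsAlmostMaximal (B : LinearMap.BilinForm ℝ V) (e : V) (Γ : Submodule ℤ V) (f : V → ℝ)
    (F : ℝ) (γ : ℝ → V ⧸ Γ) (I : Set ℝ) : Prop :=
  IsCausalCurve B e Γ γ I ∧
    ∃ c, IsLift Γ γ I c ∧ ∀ s ∈ I, ∀ t ∈ I, s ≤ t →
      (timeSep B e f (c s) (c t) : EReal) - (F : EReal) ≤ (curveLength B f c s t : EReal)

end ConfTorus

end

noncomputable section

namespace ConfTorus

/-! Write vectors in Lorentzian coordinates `(τ, X)` and put `depth = τ - ‖X‖`. Depth is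
superadditive and nonnegative on the causal cone, and lying in a strict subcone amounts to a bound
`depth ≥ κ * τ`. Since `-B v v` is comparable to `depth * τ`, and periodicity gives `0 < m ≤ f ≤ M`,
a straight causal segment has length at least `m * √(depth * τ)`, while every causal curve with the
same displacement has length at most `M * (r * depth + τ / r)` for each `r > 0` (`curveLength_le`).

The engine is `depth_ge_of_separated`, a cut-and-paste argument. Suppose the curve has gained depth
on a bounded piece, and `k` is a part of that displacement with depth at least `h`. Remove `k`
there, add it to a distant piece with time extent `T`, and translate the curve in between by `∓k`.
If the distant piece were nearly lightlike, it would gain length of order `√(h * T)`, while the loss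
stays bounded; for large `T` this contradicts almost maximality. So every long piece has depth
bounded below.

The translation preserves length only if `k` is a period of `f` or nothing lies in between. Hence
adjacent pieces are treated first: the timelike displacement yields a bounded piece of definite
depth (`exists_initial_piece`), and adjoining neighbours makes its depth as large as desired
(`exists_depth_ge`). Then a lattice vector near half of its displacement serves as `k`, and distant
pieces can be handled. Superadditivity turns the gain per piece into linear growth of depth
(`exists_depth_ratio`). -/

/-- A splitting of a Lorentzian vector space into a time coordinate `τ`, positive on the
time-orientation `e`, and Euclidean space coordinates `X`. -/
structure Splitting {V : Type*} [NormedAddCommGroup V] [NormedSpace ℝ V]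
    (B : LinearMap.BilinForm ℝ V) (e : V) where
  n : ℕ
  τ : V →L[ℝ] ℝ
  X : V →L[ℝ] EuclideanSpace ℝ (Fin n)
  form : ∀ v w, B v w = -(τ v * τ w) + inner ℝ (X v) (X w)
  inj : ∀ v, τ v = 0 → X v = 0 → v = 0
  unit : V
  τ_unit : τ unit = 1
  X_unit : X unit = 0
  τ_pos : 0 < τ e

/-! ### Linear algebra of the causal cone in terms of time and depth. -/

section
variable {V : Type*} [NormedAddCommGroup V] [NormedSpace ℝ V]
  {B : LinearMap.BilinForm ℝ V} {e : V}

theorem IsLorentzForm.exists_splitting [FiniteDimensional ℝ V] (hB : IsLorentzForm B)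
    (he : B e e < 0) : Nonempty (Splitting B e) := by
  obtain ⟨n, b, hb⟩ := hB
  let Y : V →ₗ[ℝ] EuclideanSpace ℝ (Fin n) :=
    (WithLp.linearEquiv 2 ℝ (Fin n → ℝ)).symm.toLinearMap ∘ₗ
      LinearMap.pi fun i : Fin n => b.coord i.succ
  have hY : ∀ v i, Y v i = b.repr v i.succ := fun v i => rfl
  have hform : ∀ v w, B v w = -(b.repr v 0 * b.repr w 0) + inner ℝ (Y v) (Y w) := by
    intro v w
    have h1 : B v w = ∑ i, ∑ j, b.repr v i * (b.repr w j * B (b i) (b j)) := by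
      conv_lhs => rw [← b.sum_repr v, ← b.sum_repr w]
      simp only [map_sum, map_smul, LinearMap.sum_apply, LinearMap.smul_apply, smul_eq_mul,
        Finset.mul_sum]
      rw [Finset.sum_comm]
      exact Finset.sum_congr rfl fun i _ => Finset.sum_congr rfl fun j _ => mul_left_comm _ _ _
    rw [h1]
    simp_rw [hb]
    simp [Fin.sum_univ_succ, hY, PiLp.inner_apply, mul_comm, Fin.succ_ne_zero]
  have hinj : ∀ v, b.repr v 0 = 0 → Y v = 0 → v = 0 := by
    intro v h0 h1
    apply b.repr.injective
    ext i
    rcases Fin.eq_zero_or_eq_succ i with rfl | ⟨j, rfl⟩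
    · simpa using h0
    · rw [← hY, h1]; simp
  have hτ : b.repr e 0 ≠ 0 := by
    intro h
    rw [hform, h, real_inner_self_eq_norm_sq] at he
    nlinarith [sq_nonneg ‖Y e‖]
  -- The sign `σ` orients the time coordinate so that it is positive on `e`; it drops out of the
  -- form.
  have key : ∀ σ : ℝ, σ * σ = 1 → 0 < σ * b.repr e 0 → Nonempty (Splitting B e) := by
    intro σ hσ hpos
    refine ⟨⟨n, LinearMap.toContinuousLinearMap (σ • b.coord 0), LinearMap.toContinuousLinearMap Y,
      ?_, ?_, σ • b 0, ?_, ?_, ?_⟩⟩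
    · intro v w
      simp only [LinearMap.coe_toContinuousLinearMap', LinearMap.smul_apply, smul_eq_mul,
        Module.Basis.coord_apply]
      rw [hform]
      linear_combination (b.repr v 0 * b.repr w 0) * hσ
    · intro v h0 h1
      have hσ0 : σ ≠ 0 := by rintro rfl; simp at hσ
      refine hinj v ?_ (by simpa using h1)
      simpa [hσ0] using h0
    · simp [hσ]
    · ext i
      simp [hY]
    · simpa using hpos
  rcases lt_or_gt_of_ne hτ with h | h
  · exact key (-1) (by norm_num) (by linarith)
  · exact key 1 (by norm_num) (by linarith)

namespace Splitting

variable (S : Splitting B e)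

/-- The signed Euclidean depth of a vector inside the future cone. -/
def depth (v : V) : ℝ := S.τ v - ‖S.X v‖

theorem depth_zero : S.depth 0 = 0 := by simp [depth]

theorem depth_le_τ (v : V) : S.depth v ≤ S.τ v := by
  have := norm_nonneg (S.X v); unfold depth; linarith

theorem depth_add (v w : V) : S.depth v + S.depth w ≤ S.depth (v + w) := by
  have := norm_add_le (S.X v) (S.X w)
  simp only [depth, map_add]; linarith

theorem depth_smul {r : ℝ} (hr : 0 ≤ r) (v : V) : S.depth (r • v) = r * S.depth v := by
  simp only [depth, map_smul, norm_smul, Real.norm_of_nonneg hr, smul_eq_mul]; ring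

theorem neg_form_self (v : V) : -B v v = S.depth v * (S.τ v + ‖S.X v‖) := by
  rw [S.form, real_inner_self_eq_norm_sq, depth]; ring

theorem τ_pos_of_depth {v : V} (h0 : v ≠ 0) (h : 0 ≤ S.depth v) : 0 < S.τ v := by
  have h1 : ‖S.X v‖ ≤ S.τ v := by unfold depth at h; linarith
  rcases (norm_nonneg (S.X v)).lt_or_eq with h2 | h2
  · linarith
  · rcases (h2.trans_le h1).lt_or_eq with h3 | h3
    · exact h3
    · exact absurd (S.inj v h3.symm (norm_eq_zero.1 h2.symm)) h0

/-- By Cauchy–Schwarz and `‖X e‖ < τ e`, the sign of `B e v` for causal `v` is opposite to that of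
`τ v`. -/
theorem mem_futureCone_iff (he : B e e < 0) (v : V) :
    v ∈ futureCone B e ↔ v ≠ 0 ∧ 0 ≤ S.depth v := by
  have hX : ‖S.X e‖ < S.τ e := by
    rw [S.form, real_inner_self_eq_norm_sq] at he
    exact lt_of_pow_lt_pow_left₀ 2 S.τ_pos.le (by linarith)
  have hin := abs_le.1 (abs_real_inner_le_norm (S.X e) (S.X v))
  have hn := norm_nonneg (S.X v)
  have hne := norm_nonneg (S.X e)
  constructor
  · rintro ⟨h0, h1, h2⟩
    refine ⟨h0, ?_⟩
    rw [S.form, real_inner_self_eq_norm_sq] at h1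
    rw [S.form] at h2
    have hle : ‖S.X v‖ ≤ |S.τ v| := by
      rw [← abs_of_nonneg hn]; exact sq_le_sq.1 (by linarith)
    by_cases hτ : 0 ≤ S.τ v
    · rw [abs_of_nonneg hτ] at hle; unfold depth; linarith
    · rw [abs_of_neg (not_le.1 hτ)] at hle
      have : ‖S.X e‖ * ‖S.X v‖ ≤ S.τ e * -S.τ v := mul_le_mul hX.le hle hn S.τ_pos.le
      linarith
  · rintro ⟨h0, h1⟩
    have hτ := S.τ_pos_of_depth h0 h1
    refine ⟨h0, ?_, ?_⟩
    · have := S.neg_form_self v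
      have := mul_nonneg h1 (add_nonneg hτ.le hn)
      linarith
    · rw [S.form]
      have h2 : ‖S.X v‖ ≤ S.τ v := by unfold depth at h1; linarith
      have : ‖S.X e‖ * ‖S.X v‖ ≤ ‖S.X e‖ * S.τ v := mul_le_mul_of_nonneg_left h2 hne
      have : ‖S.X e‖ * S.τ v < S.τ e * S.τ v := mul_lt_mul_of_pos_right hX hτ
      linarith

/-- `√(-B(v,v))` is bounded by the arithmetic mean of scaled depth and time. -/
theorem sqrt_abs_form_le {v : V} (h : 0 ≤ S.depth v) {r : ℝ} (hr : 0 < r) :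
    Real.sqrt |B v v| ≤ r * S.depth v + S.τ v / r := by
  have hn := norm_nonneg (S.X v)
  have hle : ‖S.X v‖ ≤ S.τ v := by unfold depth at h; linarith
  have hτ : 0 ≤ S.τ v := hn.trans hle
  apply Real.sqrt_le_iff.2
  refine ⟨by positivity, ?_⟩
  rw [← abs_neg, S.neg_form_self, abs_of_nonneg (by positivity)]
  have h1 : S.depth v * (S.τ v + ‖S.X v‖) ≤ S.depth v * (2 * S.τ v) :=
    mul_le_mul_of_nonneg_left (by linarith) h
  have h2 : (r * S.depth v) * (S.τ v / r) = S.depth v * S.τ v := by field_simp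
  nlinarith [sq_nonneg (r * S.depth v), sq_nonneg (S.τ v / r)]

theorem sqrt_depth_mul_τ_le {v : V} (h : 0 ≤ S.depth v) :
    Real.sqrt (S.depth v * S.τ v) ≤ Real.sqrt |B v v| := by
  have hn := norm_nonneg (S.X v)
  have hle : ‖S.X v‖ ≤ S.τ v := by unfold depth at h; linarith
  have hτ : 0 ≤ S.τ v := hn.trans hle
  apply Real.sqrt_le_sqrt
  rw [← abs_neg, S.neg_form_self, abs_of_nonneg (by positivity)]
  exact mul_le_mul_of_nonneg_left (by linarith) h

/-- A linear functional that supports the depth function at `w` and dominates it everywhere. -/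
theorem exists_support (w : V) :
    ∃ ℓ : V →L[ℝ] ℝ, ℓ w = S.depth w ∧ ∀ v, S.depth v ≤ ℓ v := by
  by_cases h : S.X w = 0
  · exact ⟨S.τ, by simp [depth, h], S.depth_le_τ⟩
  · have hn : 0 < ‖S.X w‖ := norm_pos_iff.2 h
    refine ⟨S.τ - (‖S.X w‖⁻¹ • innerSL ℝ (S.X w)) ∘L S.X, ?_, fun v => ?_⟩
    · simp [depth]
      field_simp
    · have h1 := real_inner_le_norm (S.X w) (S.X v)
      have h2 : ‖S.X w‖⁻¹ * inner ℝ (S.X w) (S.X v) ≤ ‖S.X v‖ := by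
        rw [inv_mul_le_iff₀ hn]; exact h1
      simp [depth]
      linarith

/-- Constants comparing the time coordinate and the depth with the given norm. -/
theorem exists_bounds [FiniteDimensional ℝ V] : ∃ A : ℝ, 0 < A ∧ (∀ v, |S.τ v| ≤ A * ‖v‖) ∧
    (∀ v, |S.depth v| ≤ A * ‖v‖) ∧ (∀ v, 0 ≤ S.depth v → ‖v‖ ≤ A * S.τ v) := by
  let P : V →ₗ[ℝ] ℝ × EuclideanSpace ℝ (Fin S.n) := (S.τ.prod S.X).toLinearMap
  have hker : LinearMap.ker P = ⊥ := by
    rw [LinearMap.ker_eq_bot']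
    intro v hv
    exact S.inj v (congrArg Prod.fst hv) (congrArg Prod.snd hv)
  obtain ⟨C, hC, hP⟩ := P.exists_antilipschitzWith hker
  have hτ := S.τ.le_opNorm
  have hX := S.X.le_opNorm
  have h1 := norm_nonneg S.τ
  have h2 := norm_nonneg S.X
  have hC0 : (0 : ℝ) ≤ C := C.coe_nonneg
  refine ⟨‖S.τ‖ + ‖S.X‖ + C, by positivity, fun v => ?_, fun v => ?_, fun v hv => ?_⟩
  · have := hτ v
    rw [Real.norm_eq_abs] at this
    nlinarith [norm_nonneg v, hC0, mul_nonneg (add_nonneg h2 hC0) (norm_nonneg v)]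
  · have h3 := hτ v
    have h4 := hX v
    rw [Real.norm_eq_abs] at h3
    have h5 : |S.depth v| ≤ |S.τ v| + ‖S.X v‖ := by
      unfold depth
      exact (abs_sub _ _).trans (by simp)
    nlinarith [mul_nonneg hC0 (norm_nonneg v)]
  · have h3 := hP.le_mul_norm_sub 0 v
    have hle : ‖S.X v‖ ≤ S.τ v := by unfold depth at hv; linarith
    have h4 : ‖P v‖ ≤ S.τ v := by
      refine (Prod.norm_def (P v)).trans_le (max_le ?_ hle)
      exact (abs_of_nonneg ((norm_nonneg _).trans hle)).le
    simp only [map_zero, neg_zero, zero_add] at h3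
    have h5 : (C : ℝ) * ‖P v‖ ≤ C * S.τ v := mul_le_mul_of_nonneg_left h4 hC0
    nlinarith [mul_nonneg (add_nonneg h1 h2) ((norm_nonneg _).trans hle)]

theorem depth_eq_zero_of_mem_frontier (he : B e e < 0) {y : V}
    (hy : y ∈ frontier (futureCone B e)) : S.depth y = 0 := by
  have hcont : Continuous S.depth := S.τ.continuous.sub S.X.continuous.norm
  rcases lt_trichotomy (S.depth y) 0 with h | h | h
  · exfalso
    have : y ∈ closure (futureCone B e) := frontier_subset_closure hy
    have hsub : closure (futureCone B e) ⊆ {v | 0 ≤ S.depth v} :=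
      closure_minimal (fun v hv => ((S.mem_futureCone_iff he v).1 hv).2)
        (isClosed_le continuous_const hcont)
    exact absurd (hsub this) (not_le.2 h)
  · exact h
  · exfalso
    have hopen : IsOpen {v | 0 < S.depth v} := isOpen_lt continuous_const hcont
    have : y ∈ interior (futureCone B e) := by
      refine interior_maximal (fun v hv => (S.mem_futureCone_iff he v).2 ⟨?_, le_of_lt hv⟩) hopen h
      rintro rfl
      exact lt_irrefl _ (S.depth_zero ▸ hv : (0 : ℝ) < 0)
    exact hy.2 this

/-- Moving along `unit` changes depth at unit rate, so `y` is a limit of points inside and of points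
outside the cone. -/
theorem mem_frontier_of_depth_eq_zero (he : B e e < 0) {y : V} (hy : S.depth y = 0) :
    y ∈ frontier (futureCone B e) := by
  have hd : ∀ r : ℝ, S.depth (y + r • S.unit) = r := by
    intro r
    have : S.depth (y + r • S.unit) = S.depth y + r := by
      simp [depth, S.τ_unit, S.X_unit]; ring
    rw [this, hy, zero_add]
  have ht : Filter.Tendsto (fun r : ℝ => y + r • S.unit) (nhds 0) (nhds y) := by
    have : Continuous fun r : ℝ => y + r • S.unit := by fun_prop
    simpa using this.tendsto 0
  rw [frontier_eq_closure_inter_closure]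
  constructor
  · refine mem_closure_of_tendsto (ht.mono_left (nhdsWithin_le_nhds (s := Ioi 0))) ?_
    filter_upwards [self_mem_nhdsWithin] with r hr
    refine (S.mem_futureCone_iff he _).2 ⟨?_, by rw [hd]; exact le_of_lt hr⟩
    intro h0
    have := hd r
    rw [h0, depth_zero] at this
    exact hr.ne this
  · refine mem_closure_of_tendsto (ht.mono_left (nhdsWithin_le_nhds (s := Iio 0))) ?_
    filter_upwards [self_mem_nhdsWithin] with r hr
    intro hmem
    have := ((S.mem_futureCone_iff he _).1 hmem).2
    rw [hd] at this
    exact absurd this (not_le.2 hr)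

/-- Subtracting `depth v • unit` lands on the boundary, so the distance to it is at most `depth v *
‖unit‖`. -/
theorem depth_ge_of_mem_strictCone [FiniteDimensional ℝ V] (he : B e e < 0) {ε : ℝ} (hε : 0 < ε) :
    ∃ κ : ℝ, 0 < κ ∧ ∀ v ∈ strictCone B e ε, κ * S.τ v ≤ S.depth v := by
  obtain ⟨A, hA, h1, -, -⟩ := S.exists_bounds
  have hu : 0 < ‖S.unit‖ := by
    rw [norm_pos_iff]; intro h
    have := S.τ_unit
    rw [h, map_zero] at this; exact zero_ne_one this
  refine ⟨ε / (A * ‖S.unit‖), by positivity, fun v hv => ?_⟩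
  have hv0 := ((S.mem_futureCone_iff he v).1 hv.1).2
  have hfr : v - S.depth v • S.unit ∈ frontier (futureCone B e) := by
    apply S.mem_frontier_of_depth_eq_zero he
    simp [depth, S.τ_unit, S.X_unit]
  have h2 := hv.2.trans (Metric.infDist_le_dist_of_mem hfr)
  rw [dist_eq_norm, sub_sub_cancel, norm_smul, Real.norm_of_nonneg hv0] at h2
  have h3 := (le_abs_self _).trans (h1 v)
  rw [div_mul_eq_mul_div, div_le_iff₀ (by positivity)]
  nlinarith [mul_le_mul_of_nonneg_left h3 hε.le, mul_le_mul_of_nonneg_left h2 hA.le]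

/-- Depth is Lipschitz and vanishes on the boundary, so it bounds the distance to the boundary from
below. -/
theorem mem_strictCone_of_depth_ge [FiniteDimensional ℝ V] (he : B e e < 0) {κ : ℝ} (hκ : 0 < κ) :
    ∃ δ : ℝ, 0 < δ ∧ ∀ v, v ≠ 0 → 0 ≤ S.depth v → κ * S.τ v ≤ S.depth v →
      v ∈ strictCone B e δ := by
  obtain ⟨A, hA, -, -, h2⟩ := S.exists_bounds
  refine ⟨κ / (A * (‖S.τ‖ + ‖S.X‖ + 1)), by positivity, fun v hv h0 hk =>
    ⟨(S.mem_futureCone_iff he v).2 ⟨hv, h0⟩, ?_⟩⟩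
  have hne : (frontier (futureCone B e)).Nonempty :=
    ⟨0, S.mem_frontier_of_depth_eq_zero he S.depth_zero⟩
  refine (Metric.le_infDist hne).2 fun y hy => ?_
  have hy0 := S.depth_eq_zero_of_mem_frontier he hy
  have h3 : S.depth v ≤ (‖S.τ‖ + ‖S.X‖ + 1) * dist v y := by
    have e1 : S.τ v - S.τ y ≤ ‖S.τ‖ * ‖v - y‖ := by
      rw [← map_sub]; exact (le_abs_self _).trans (S.τ.le_opNorm _)
    have e2 : ‖S.X y‖ - ‖S.X v‖ ≤ ‖S.X‖ * ‖v - y‖ := by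
      refine (norm_sub_norm_le _ _).trans ?_
      rw [← map_sub, norm_sub_rev v y]; exact S.X.le_opNorm _
    rw [dist_eq_norm]
    unfold depth at hy0 ⊢
    nlinarith [norm_nonneg (v - y)]
  have h4 := h2 v h0
  rw [div_mul_eq_mul_div, div_le_iff₀ (by positivity)]
  nlinarith [mul_le_mul_of_nonneg_left h4 hκ.le, mul_le_mul_of_nonneg_left h3 hA.le,
    mul_le_mul_of_nonneg_left hk hA.le]

end Splitting

end

end ConfTorus

end

/-! ### Causal curves: restriction, translation, concatenation, integration. -/

noncomputable section

/-- Monotonicity keeps disjoint intervals disjoint, and the Lipschitz bound keeps their total length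
small. It is applied to shifts and to the truncations `min t b`, `max t b`. -/
theorem AbsolutelyContinuousOnInterval.comp_monotone {X : Type*} [PseudoMetricSpace X]
    {f : ℝ → X} {φ : ℝ → ℝ} {a b a' b' : ℝ} (hf : AbsolutelyContinuousOnInterval f a' b')
    (hφ : Monotone φ) (hL : LipschitzWith 1 φ) (hmaps : MapsTo φ (uIcc a b) (uIcc a' b')) :
    AbsolutelyContinuousOnInterval (fun t => f (φ t)) a b := by
  rw [absolutelyContinuousOnInterval_iff] at hf ⊢
  intro ε hε
  obtain ⟨δ, hδ, h⟩ := hf ε hε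
  refine ⟨δ, hδ, fun E hE hsum => ?_⟩
  refine h (E.1, fun i => (φ (E.2 i).1, φ (E.2 i).2)) ⟨fun i hi => ?_, ?_⟩ ?_
  · exact ⟨hmaps (hE.1 i hi).1, hmaps (hE.1 i hi).2⟩
  · intro i hi j hj hij
    have hd := hE.2 hi hj hij
    simp only [Function.onFun, uIoc] at hd ⊢
    rw [Set.Ioc_disjoint_Ioc] at hd ⊢
    simpa only [hφ.map_min, hφ.map_max] using hφ hd
  · refine lt_of_le_of_lt (Finset.sum_le_sum fun i _ => ?_) hsum
    simpa using hL.dist_le_mul (E.2 i).1 (E.2 i).2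

theorem AbsolutelyContinuousOnInterval.congr_of_eqOn {X : Type*} [PseudoMetricSpace X]
    {c c' : ℝ → X} {a b : ℝ} (h : AbsolutelyContinuousOnInterval c a b)
    (h' : EqOn c c' (uIcc a b)) : AbsolutelyContinuousOnInterval c' a b := by
  rw [absolutelyContinuousOnInterval_iff] at h ⊢
  intro ε hε
  obtain ⟨δ, hδ, H⟩ := h ε hε
  refine ⟨δ, hδ, fun E hE hsum => ?_⟩
  have := H E hE hsum
  rwa [Finset.sum_congr rfl fun i hi => by rw [h' (hE.1 i hi).1, h' (hE.1 i hi).2]] at this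

namespace ConfTorus

section
variable {V : Type*} [NormedAddCommGroup V] [NormedSpace ℝ V]
  {B : LinearMap.BilinForm ℝ V} {e : V} {f : V → ℝ} {c c' : ℝ → V} {I J : Set ℝ}

theorem IsFutureCausal.mono (h : IsFutureCausal B e c I) (hJ : J ⊆ I) : IsFutureCausal B e c J :=
  ⟨fun s hs t ht => h.1 s (hJ hs) t (hJ ht), ae_mono (Measure.restrict_mono hJ le_rfl) h.2⟩

theorem isFutureCausal_Icc {a b : ℝ} (hab : a ≤ b) (h : AbsolutelyContinuousOnInterval c a b)
    (h' : ∀ᵐ t, t ∈ Ioo a b → deriv c t ∈ futureCone B e) : IsFutureCausal B e c (Icc a b) := by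
  refine ⟨fun s hs t ht => h.mono ?_, ?_⟩
  · rw [uIcc_of_le hab]
    exact ordConnected_Icc.uIcc_subset hs ht
  · rwa [← Measure.restrict_congr_set Ioo_ae_eq_Icc, ae_restrict_iff' measurableSet_Ioo]

theorem IsFutureCausal.ae_Ioo {a b : ℝ} (h : IsFutureCausal B e c (Icc a b)) :
    ∀ᵐ t, t ∈ Ioo a b → deriv c t ∈ futureCone B e := by
  rw [← ae_restrict_iff' measurableSet_Ioo, Measure.restrict_congr_set Ioo_ae_eq_Icc]
  exact h.2

theorem deriv_eq_of_eqOn_Ioo {a b t : ℝ} (h : EqOn c c' (Ioo a b)) (ht : t ∈ Ioo a b) :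
    deriv c t = deriv c' t :=
  Filter.EventuallyEq.deriv_eq (h.eventuallyEq_of_mem (Ioo_mem_nhds ht.1 ht.2))

theorem curveLength_congr {a b : ℝ} (h : EqOn c c' (Icc a b)) :
    curveLength B f c a b = curveLength B f c' a b := by
  unfold curveLength
  rw [← Measure.restrict_congr_set (Ioo_ae_eq_Icc (a := a) (b := b))]
  refine setLIntegral_congr_fun measurableSet_Ioo fun t ht => ?_
  simp only [deriv_eq_of_eqOn_Ioo (h.mono Ioo_subset_Icc_self) ht, h (Ioo_subset_Icc_self ht)]

theorem curveLength_add {a b d : ℝ} (hab : a ≤ b) (hbd : b ≤ d) :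
    curveLength B f c a b + curveLength B f c b d = curveLength B f c a d := by
  unfold curveLength
  rw [← Icc_union_Ioc_eq_Icc hab hbd, lintegral_union measurableSet_Ioc,
    Measure.restrict_congr_set (Ioc_ae_eq_Icc (a := b) (b := d))]
  exact disjoint_left.2 fun x hx hx' => not_lt.2 hx.2 hx'.1

/-- There is a future pointing causal curve from `x` to `y` of length at least `l`. -/
def Reach (B : LinearMap.BilinForm ℝ V) (e : V) (f : V → ℝ) (x y : V) (l : ℝ≥0∞) : Prop :=
  ∃ (a b : ℝ) (c : ℝ → V), a ≤ b ∧ IsFutureCausal B e c (Icc a b) ∧ c a = x ∧ c b = y ∧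
    l ≤ curveLength B f c a b

theorem Reach.le_timeSep {x y : V} {l : ℝ≥0∞} (h : Reach B e f x y l) : l ≤ timeSep B e f x y := by
  obtain ⟨a, b, c, hab, hc, ha, hb, hl⟩ := h
  refine hl.trans ?_
  unfold timeSep
  exact le_iSup_of_le a <| le_iSup_of_le b <| le_iSup_of_le c <| le_iSup_of_le hab <|
    le_iSup_of_le hc <| le_iSup_of_le ha <| le_iSup_of_le hb le_rfl

theorem IsFutureCausal.shift {a b : ℝ} (hab : a ≤ b) (hc : IsFutureCausal B e c (Icc a b)) (h : ℝ)
    (k : V) : IsFutureCausal B e (fun t => c (t - h) + k) (Icc (a + h) (b + h)) := by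
  refine isFutureCausal_Icc (by linarith) ?_ ?_
  · have h1 : AbsolutelyContinuousOnInterval (fun t => c (t - h)) (a + h) (b + h) := by
      refine (hc.1 a (left_mem_Icc.2 hab) b (right_mem_Icc.2 hab)).comp_monotone
        (φ := fun t => t - h) (fun x y hxy => by simpa using hxy) ?_ ?_
      · exact LipschitzWith.of_dist_le_mul fun x y => by simp
      · rw [uIcc_of_le hab, uIcc_of_le (by linarith)]
        exact fun t ht => ⟨by linarith [ht.1], by linarith [ht.2]⟩
    rw [absolutelyContinuousOnInterval_iff] at h1 ⊢
    simpa using h1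
  · have := (measurePreserving_sub_right volume h).quasiMeasurePreserving.ae hc.ae_Ioo
    filter_upwards [this] with t ht htI
    rw [deriv_add_const, deriv_comp_sub_const]
    exact ht ⟨by linarith [htI.1], by linarith [htI.2]⟩

theorem curveLength_shift (a b h : ℝ) {k : V} (hk : ∀ x, f (x + k) = f x) :
    curveLength B f (fun t => c (t - h) + k) (a + h) (b + h) = curveLength B f c a b := by
  unfold curveLength
  have := (measurePreserving_sub_right volume h).setLIntegral_comp_preimage_emb
    (measurableEmbedding_subRight h)
    (fun τ => ENNReal.ofReal (Real.sqrt |metric B f (c τ) (deriv c τ) (deriv c τ)|)) (Icc a b)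
  rw [← this]
  have hpre : (fun x => x - h) ⁻¹' Icc a b = Icc (a + h) (b + h) := by
    simp
  rw [hpre]
  simp only [metric, hk, deriv_add_const, deriv_comp_sub_const]

theorem Reach.translate {x y k : V} {l : ℝ≥0∞} (h : Reach B e f x y l)
    (hk : ∀ x, f (x + k) = f x) : Reach B e f (x + k) (y + k) l := by
  obtain ⟨a, b, c, hab, hc, rfl, rfl, hl⟩ := h
  refine ⟨a + 0, b + 0, fun t => c (t - 0) + k, by simpa, hc.shift hab 0 k, by simp, by simp, ?_⟩
  rwa [curveLength_shift a b 0 hk]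

theorem Reach.trans {x y z : V} {l l' : ℝ≥0∞} (h : Reach B e f x y l) (h' : Reach B e f y z l') :
    Reach B e f x z (l + l') := by
  obtain ⟨a, b, c₁, hab, hc₁, rfl, rfl, hl⟩ := h
  obtain ⟨a', b', c₂', hab', hc₂', ha', rfl, hl'⟩ := h'
  obtain ⟨d, c₂, hbd, hc₂, hb, hd, hl₂⟩ : ∃ (d : ℝ) (c₂ : ℝ → V), b ≤ d ∧
      IsFutureCausal B e c₂ (Icc b d) ∧ c₂ b = c₁ b ∧ c₂ d = c₂' b' ∧
      l' ≤ curveLength B f c₂ b d := by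
    have e1 : a' + (b - a') = b := by ring
    refine ⟨b' + (b - a'), fun t => c₂' (t - (b - a')) + 0, by linarith, ?_, by simp [ha'], by simp,
      ?_⟩
    · simpa only [e1] using hc₂'.shift hab' (b - a') 0
    · have := curveLength_shift (B := B) (f := f) (c := c₂') a' b' (b - a') (k := 0) (by simp)
      rw [e1] at this
      rwa [this]
  -- Writing the concatenation as a stopped curve plus an increment makes it a sum of two absolutely
  -- continuous functions.
  set c : ℝ → V := fun t => c₁ (min t b) + (c₂ (max t b) - c₂ b) with hcdef
  have hleft : EqOn c c₁ (Icc a b) := fun t ht => by simp [hcdef, ht.2]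
  have hright : EqOn c c₂ (Icc b d) := fun t ht => by simp [hcdef, ht.1, hb]
  have had := hab.trans hbd
  refine ⟨a, d, c, had, isFutureCausal_Icc had ?_ ?_, hleft (left_mem_Icc.2 hab), ?_, ?_⟩
  · have h1 : AbsolutelyContinuousOnInterval (fun t => c₁ (min t b)) a d := by
      refine (hc₁.1 a (left_mem_Icc.2 hab) b (right_mem_Icc.2 hab)).comp_monotone
        (φ := fun t => min t b) (fun x y hxy => min_le_min_right b hxy)
        (LipschitzWith.id.min_const b) ?_
      rw [uIcc_of_le hab, uIcc_of_le had]
      exact fun t ht => ⟨le_min ht.1 hab, min_le_right _ _⟩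
    have h2 : AbsolutelyContinuousOnInterval (fun t => c₂ (max t b)) a d := by
      refine (hc₂.1 b (left_mem_Icc.2 hbd) d (right_mem_Icc.2 hbd)).comp_monotone
        (φ := fun t => max t b) (fun x y hxy => max_le_max_right b hxy)
        (LipschitzWith.id.max_const b) ?_
      rw [uIcc_of_le hbd, uIcc_of_le had]
      exact fun t ht => ⟨le_max_right _ _, max_le ht.2 hbd⟩
    have h3 := h1.add h2
    rw [absolutelyContinuousOnInterval_iff] at h3 ⊢
    simpa [hcdef, ← add_sub_assoc] using h3
  · have hne : ∀ᵐ t : ℝ, t ≠ b := by simp [ae_iff]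
    filter_upwards [hc₁.ae_Ioo, hc₂.ae_Ioo, hne] with t h1 h2 h3 ht
    rcases lt_or_gt_of_ne h3 with h | h
    · rw [deriv_eq_of_eqOn_Ioo (hleft.mono Ioo_subset_Icc_self) ⟨ht.1, h⟩]
      exact h1 ⟨ht.1, h⟩
    · rw [deriv_eq_of_eqOn_Ioo (hright.mono Ioo_subset_Icc_self) ⟨h, ht.2⟩]
      exact h2 ⟨h, ht.2⟩
  · rw [hright (right_mem_Icc.2 hbd), hd]
  · rw [← curveLength_add hab hbd, curveLength_congr hleft, curveLength_congr hright]
    exact add_le_add hl hl₂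

theorem IsFutureCausal.integral_deriv (ℓ : V →L[ℝ] ℝ) {s t : ℝ}
    (hc : IsFutureCausal B e c (Icc s t)) (hst : s ≤ t) :
    IntegrableOn (fun u => ℓ (deriv c u)) (Icc s t) ∧
      ∫ u in Icc s t, ℓ (deriv c u) = ℓ (c t - c s) := by
  have hAC : AbsolutelyContinuousOnInterval (fun u => ℓ (c u)) s t := by
    have h := hc.1 s (left_mem_Icc.2 hst) t (right_mem_Icc.2 hst)
    rw [absolutelyContinuousOnInterval_iff] at h ⊢
    intro ε hε
    obtain ⟨δ, hδ, H⟩ := h (ε / (‖ℓ‖ + 1)) (by positivity)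
    refine ⟨δ, hδ, fun E hE hsum => ?_⟩
    have h1 := H E hE hsum
    rw [lt_div_iff₀ (by positivity)] at h1
    refine lt_of_le_of_lt ?_ h1
    rw [Finset.sum_mul]
    refine Finset.sum_le_sum fun i _ => ?_
    rw [dist_eq_norm, dist_eq_norm, ← map_sub]
    nlinarith [ℓ.le_opNorm (c (E.2 i).1 - c (E.2 i).2), norm_nonneg (c (E.2 i).1 - c (E.2 i).2)]
  have hder : (fun u => ℓ (deriv c u)) =ᵐ[volume.restrict (Icc s t)]
      deriv (fun u => ℓ (c u)) := by
    filter_upwards [hc.2] with u hu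
    -- The cone omits `0`, which is the default value of `deriv`, so a causal velocity is a genuine
    -- derivative.
    have hdiff : DifferentiableAt ℝ c u := by
      by_contra h
      exact hu.1 (deriv_zero_of_not_differentiableAt h)
    exact ((ℓ.hasFDerivAt.comp_hasDerivAt u hdiff.hasDerivAt).deriv).symm
  have hint : IntegrableOn (deriv fun u => ℓ (c u)) (Icc s t) := by
    have := hAC.intervalIntegrable_deriv
    rwa [intervalIntegrable_iff_integrableOn_Icc_of_le hst] at this
  refine ⟨hint.congr hder.symm, ?_⟩
  rw [integral_congr_ae hder, integral_Icc_eq_integral_Ioc, ← intervalIntegral.integral_of_le hst,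
    hAC.integral_deriv_eq_sub, map_sub]

/-! ### Length estimates by time and depth. -/

namespace Splitting
variable (S : Splitting B e) (he : B e e < 0)
include he

theorem reach_segment {m : ℝ} (hm : 0 ≤ m) (hmf : ∀ x, m ≤ f x) (x : V) {v : V}
    (hv : 0 ≤ S.depth v) :
    Reach B e f x (x + v) (ENNReal.ofReal (m * Real.sqrt (S.depth v * S.τ v))) := by
  -- A constant curve is causal only on a degenerate interval.
  rcases eq_or_ne v 0 with rfl | h0
  · refine ⟨0, 0, fun _ => x, le_rfl, isFutureCausal_Icc le_rfl ?_ (by simp), rfl, by simp,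
      by simp⟩
    exact contDiff_const.contDiffOn.absolutelyContinuousOnInterval
  have hd : ∀ t : ℝ, deriv (fun t : ℝ => x + t • v) t = v := fun t => by
    have : HasDerivAt (fun t : ℝ => x + t • v) ((1 : ℝ) • v) t :=
      ((hasDerivAt_id t).smul_const v).const_add x
    simpa using this.deriv
  refine ⟨0, 1, fun t => x + t • v, zero_le_one, isFutureCausal_Icc zero_le_one ?_ ?_, by simp,
    by simp, ?_⟩
  · exact ContDiff.contDiffOn (by fun_prop) |>.absolutelyContinuousOnInterval
  · refine Filter.Eventually.of_forall fun t _ => ?_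
    rw [hd]
    exact (S.mem_futureCone_iff he v).2 ⟨h0, hv⟩
  · unfold curveLength
    have : ∀ t : ℝ, ENNReal.ofReal (m * Real.sqrt (S.depth v * S.τ v)) ≤
        ENNReal.ofReal (Real.sqrt |metric B f (x + t • v) (deriv (fun t : ℝ => x + t • v) t)
          (deriv (fun t : ℝ => x + t • v) t)|) := by
      intro t
      rw [hd, metric, abs_mul, abs_of_nonneg (sq_nonneg _), Real.sqrt_mul (sq_nonneg _),
        Real.sqrt_sq (hm.trans (hmf _))]
      exact ENNReal.ofReal_le_ofReal (mul_le_mul (hmf _) (S.sqrt_depth_mul_τ_le hv)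
        (Real.sqrt_nonneg _) (hm.trans (hmf _)))
    refine le_trans ?_ (lintegral_mono this)
    simp

theorem depth_displacement_nonneg {s t : ℝ} (hst : s ≤ t)
    (hc : IsFutureCausal B e c (Icc s t)) : 0 ≤ S.depth (c t - c s) := by
  obtain ⟨ℓ, h1, h2⟩ := S.exists_support (c t - c s)
  rw [← h1, ← (hc.integral_deriv ℓ hst).2]
  refine integral_nonneg_of_ae ?_
  filter_upwards [hc.2] with u hu
  exact ((S.mem_futureCone_iff he _).1 hu).2.trans (h2 _)

/-- The functional `ℓ` supporting depth at the total displacement dominates the depth of each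
velocity. The resulting pointwise bound is linear in the velocity, hence integrates to the
displacement. -/
theorem curveLength_le {M : ℝ} (hf : ∀ x, 0 < f x) (hM : ∀ x, f x ≤ M) {s t : ℝ} (hst : s ≤ t)
    (hc : IsFutureCausal B e c (Icc s t)) {r : ℝ} (hr : 0 < r) :
    curveLength B f c s t ≤
      ENNReal.ofReal (M * (r * S.depth (c t - c s) + S.τ (c t - c s) / r)) := by
  obtain ⟨ℓ, h1, h2⟩ := S.exists_support (c t - c s)
  have hM0 : 0 ≤ M := (hf 0).le.trans (hM 0)
  have hi := hc.integral_deriv (M • (r • ℓ + r⁻¹ • S.τ)) hst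
  have hval : (M • (r • ℓ + r⁻¹ • S.τ)) (c t - c s) =
      M * (r * S.depth (c t - c s) + S.τ (c t - c s) / r) := by
    rw [← h1]
    simp only [smul_apply, add_apply, smul_eq_mul]
    ring
  have hle : ∀ᵐ u ∂volume.restrict (Icc s t),
      Real.sqrt |metric B f (c u) (deriv c u) (deriv c u)| ≤
        (M • (r • ℓ + r⁻¹ • S.τ)) (deriv c u) := by
    filter_upwards [hc.2] with u hu
    have hu' := ((S.mem_futureCone_iff he _).1 hu).2
    rw [metric, abs_mul, abs_of_nonneg (sq_nonneg _), Real.sqrt_mul (sq_nonneg _),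
      Real.sqrt_sq (hf _).le]
    simp only [smul_apply, add_apply, smul_eq_mul]
    refine mul_le_mul (hM _) ((S.sqrt_abs_form_le hu' hr).trans ?_) (Real.sqrt_nonneg _) hM0
    rw [div_eq_inv_mul]
    gcongr
    exact h2 _
  rw [← hval, ← hi.2, ofReal_integral_eq_lintegral_ofReal hi.1
    (hle.mono fun u hu => (Real.sqrt_nonneg _).trans hu)]
  exact lintegral_mono_ae (hle.mono fun u hu => ENNReal.ofReal_le_ofReal hu)

end Splitting

end

/-- Two lifts of the same curve differ by a lattice translation. -/
theorem IsLift.sub_eq_sub {W : Type*} [NormedAddCommGroup W] {Γ : Submodule ℤ W}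
    [DiscreteTopology Γ] {γ : ℝ → W ⧸ Γ} {c c' : ℝ → W} {I : Set ℝ}
    (hI : I.OrdConnected) (h : IsLift Γ γ I c) (h' : IsLift Γ γ I c') {s t : ℝ} (hs : s ∈ I)
    (ht : t ∈ I) : c' s - c s = c' t - c t :=
  hI.isPreconnected.constant_of_mapsTo (T := (Γ : Set W))
    (SetLike.isDiscrete_iff_discreteTopology.2 ‹_›) (h'.1.sub h.1)
    (fun u hu => (Submodule.Quotient.eq Γ).1 ((h'.2 u hu).trans (h.2 u hu).symm)) hs ht

/-! ### Almost maximal curves: transport of displacement and gain of depth. -/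

section
variable {V : Type*} [NormedAddCommGroup V] [NormedSpace ℝ V]
  {B : LinearMap.BilinForm ℝ V} {e : V} {f : V → ℝ} {c : ℝ → V} {I : Set ℝ} {F m M : ℝ}

/-- The curve `c` in `V` is future pointing causal and almost maximal on the interval `I`. -/
structure IsAlmostMaximalLift (B : LinearMap.BilinForm ℝ V) (e : V) (f : V → ℝ) (F : ℝ)
    (c : ℝ → V) (I : Set ℝ) : Prop where
  ordConnected : I.OrdConnected
  causal : IsFutureCausal B e c I
  timeSep_le : ∀ s ∈ I, ∀ t ∈ I, s ≤ t →
    timeSep B e f (c s) (c t) ≤ curveLength B f c s t + ENNReal.ofReal F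

/-- A lower bound for `θ` obtained by optimizing a weighted arithmetic-geometric mean
inequality. -/
theorem depth_lower_bound {h T C θ : ℝ} (hm : 0 < m) (hM : 0 < M) (hh : 0 < h) (hT : 0 < T)
    (hC : 2 * C ≤ m * Real.sqrt (h * T))
    (H : ∀ r : ℝ, 0 < r → m * Real.sqrt (h * T) ≤ C + M * (r * θ + T / r)) :
    (m / (4 * M)) ^ 2 * h ≤ θ := by
  set q := Real.sqrt (h * T) with hq
  have hq0 : 0 < q := Real.sqrt_pos.2 (by positivity)
  have hqq : q * q = h * T := Real.mul_self_sqrt (by positivity)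
  -- This `r` makes `M * (T / r)` a quarter of `m * q`; `C` takes at most half, which leaves a
  -- quarter for the depth term.
  have h1 := H (4 * M * T / (m * q)) (by positivity)
  have h2 : M * (T / (4 * M * T / (m * q))) = m * q / 4 := by field_simp
  have h3 : m * q / 4 ≤ M * (4 * M * T / (m * q) * θ) := by
    rw [mul_add, h2] at h1; linarith
  have h4 : M * (4 * M * T / (m * q) * θ) = 4 * M ^ 2 * T * θ / (m * q) := by ring
  rw [h4, le_div_iff₀ (by positivity)] at h3
  have h5 : m ^ 2 * h * T ≤ 16 * M ^ 2 * θ * T := by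
    have : m * q / 4 * (m * q) = m ^ 2 * (q * q) / 4 := by ring
    rw [this, hqq] at h3
    linarith
  have h6 := le_of_mul_le_mul_right h5 hT
  rw [div_pow, div_mul_eq_mul_div, div_le_iff₀ (by positivity)]
  linarith

theorem exists_sqrt_threshold (hm : 0 < m) {h : ℝ} (hh : 0 < h) (C : ℝ) :
    ∃ N : ℝ, 0 < N ∧ ∀ T, N ≤ T → C ≤ m * Real.sqrt (h * T) := by
  refine ⟨(C / m) ^ 2 / h + 1, by positivity, fun T hT => ?_⟩
  rw [← div_le_iff₀' hm]
  apply Real.le_sqrt_of_sq_le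
  rw [← div_le_iff₀' hh]
  linarith

namespace Splitting
variable (S : Splitting B e)

theorem exists_mid (hc : IsAlmostMaximalLift B e f F c I) {s t : ℝ} (hs : s ∈ I) (ht : t ∈ I)
    (hst : s ≤ t) {N : ℝ} (h0 : 0 ≤ N) (hN : N ≤ S.τ (c t - c s)) :
    ∃ u ∈ Icc s t, S.τ (c u - c s) = N := by
  have hcont : ContinuousOn (fun u => S.τ (c u - c s)) (Icc s t) := by
    have := (hc.causal.1 s hs t ht).continuousOn
    rw [uIcc_of_le hst] at this
    exact S.τ.continuous.comp_continuousOn (this.sub continuousOn_const)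
  exact intermediate_value_Icc hst hcont ⟨by simpa using h0, hN⟩

theorem sqrt_le_of_depth {k w : V} {h : ℝ} (hk : h ≤ S.depth k) (h0 : 0 ≤ h)
    (hw : 0 ≤ S.depth w) :
    0 ≤ S.depth (w + k) ∧
      Real.sqrt (h * S.τ w) ≤ Real.sqrt (S.depth (w + k) * S.τ (w + k)) := by
  have h1 := S.depth_add w k
  have h2 := S.depth_le_τ w
  have h3 := S.depth_le_τ k
  refine ⟨by linarith, Real.sqrt_le_sqrt ?_⟩
  rw [map_add]
  exact mul_le_mul (by linarith) (by linarith) (by linarith) (by linarith)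

/-- A piece along which the length grows at least like `q * τ` contains such a piece of bounded
size. -/
theorem exists_bounded_piece {q R : ℝ} (hq : 0 ≤ q) (hR : 0 ≤ R)
    (hc : IsAlmostMaximalLift B e f F c I) (n : ℕ) :
    ∀ a ∈ I, ∀ b ∈ I, a ≤ b → R ≤ S.τ (c b - c a) → S.τ (c b - c a) ≤ 2 ^ n * (2 * R) →
      ENNReal.ofReal (q * S.τ (c b - c a)) ≤ curveLength B f c a b →
      ∃ a' ∈ I, ∃ b' ∈ I, a' ≤ b' ∧ R ≤ S.τ (c b' - c a') ∧ S.τ (c b' - c a') ≤ 2 * R ∧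
        ENNReal.ofReal (q * S.τ (c b' - c a')) ≤ curveLength B f c a' b' := by
  induction n with
  | zero =>
    intro a ha b hb hab h1 h2 h3
    exact ⟨a, ha, b, hb, hab, h1, by simpa using h2, h3⟩
  | succ n ih =>
    intro a ha b hb hab h1 h2 h3
    rcases le_total (S.τ (c b - c a)) (2 * R) with hle | hle
    · exact ⟨a, ha, b, hb, hab, h1, hle, h3⟩
    have hτ := hR.trans h1
    obtain ⟨u, hu, hua⟩ := S.exists_mid hc ha hb hab (N := S.τ (c b - c a) / 2) (by linarith)
      (by linarith)
    have huI := hc.ordConnected.out ha hb hu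
    have hub : S.τ (c b - c u) = S.τ (c b - c a) / 2 := by
      simp only [map_sub] at hua ⊢; linarith
    rw [pow_succ] at h2
    by_cases hl : ENNReal.ofReal (q * S.τ (c u - c a)) ≤ curveLength B f c a u
    · exact ih a ha u huI hu.1 (by linarith) (by linarith) hl
    by_cases hr : ENNReal.ofReal (q * S.τ (c b - c u)) ≤ curveLength B f c u b
    · exact ih u huI b hb hu.2 (by linarith) (by linarith) hr
    exfalso
    -- If both halves were too short, additivity of length would make the whole piece too short.
    have h4 := ENNReal.add_lt_add (not_le.1 hl) (not_le.1 hr)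
    rw [curveLength_add hu.1 hu.2, hua, hub, ← ENNReal.ofReal_add (by positivity) (by positivity),
      ← mul_add, add_halves] at h4
    exact absurd h3 (not_le.2 h4)

variable (he : B e e < 0)
include he

theorem depth_nonneg (hc : IsAlmostMaximalLift B e f F c I) {s t : ℝ} (hs : s ∈ I) (ht : t ∈ I)
    (hst : s ≤ t) : 0 ≤ S.depth (c t - c s) :=
  S.depth_displacement_nonneg he hst (hc.causal.mono (hc.ordConnected.out hs ht))

theorem τ_nonneg (hc : IsAlmostMaximalLift B e f F c I) {s t : ℝ} (hs : s ∈ I) (ht : t ∈ I)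
    (hst : s ≤ t) : 0 ≤ S.τ (c t - c s) :=
  (S.depth_nonneg he hc hs ht hst).trans (S.depth_le_τ _)

/-- The competitor keeps the length of the middle piece `[b, s]`. That length is finite and cancels,
so `l` is paid for by the two outer pieces and `F` alone. -/
theorem le_of_reach (hf : ∀ x, 0 < f x) (hM : ∀ x, f x ≤ M) (hF : 0 ≤ F)
    (hc : IsAlmostMaximalLift B e f F c I) {a b s t : ℝ} (ha : a ∈ I) (hb : b ∈ I) (hs : s ∈ I)
    (ht : t ∈ I) (hab : a ≤ b) (hbs : b ≤ s) (hst : s ≤ t) {l r r' : ℝ} (hr : 0 < r) (hr' : 0 < r')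
    (h : Reach B e f (c a) (c t) (ENNReal.ofReal l + curveLength B f c b s)) :
    l ≤ M * (r * S.depth (c b - c a) + S.τ (c b - c a) / r) +
      M * (r' * S.depth (c t - c s) + S.τ (c t - c s) / r') + F := by
  have hM0 : 0 ≤ M := (hf 0).le.trans (hM 0)
  have h1 := h.le_timeSep.trans (hc.timeSep_le a ha t ht (hab.trans (hbs.trans hst)))
  have hbs' := hc.causal.mono (hc.ordConnected.out hb hs)
  have hfin : curveLength B f c b s ≠ ⊤ :=
    ((S.curveLength_le he hf hM hbs hbs' one_pos).trans_lt ENNReal.ofReal_lt_top).ne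
  have h2 := S.curveLength_le he hf hM hab (hc.causal.mono (hc.ordConnected.out ha hb)) hr
  have h3 := S.curveLength_le he hf hM hst (hc.causal.mono (hc.ordConnected.out hs ht)) hr'
  rw [← curveLength_add hab (hbs.trans hst), ← curveLength_add hbs hst] at h1
  have h4 : ENNReal.ofReal l + curveLength B f c b s ≤ (curveLength B f c a b +
      curveLength B f c s t + ENNReal.ofReal F) + curveLength B f c b s := by
    refine h1.trans_eq ?_
    ring
  rw [ENNReal.add_le_add_iff_right hfin] at h4
  have e1 := S.depth_nonneg he hc ha hb hab
  have e2 := S.τ_nonneg he hc ha hb hab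
  have e3 := S.depth_nonneg he hc hs ht hst
  have e4 := S.τ_nonneg he hc hs ht hst
  have h5 := h4.trans (add_le_add_left (add_le_add h2 h3) _)
  rw [← ENNReal.ofReal_add (by positivity) (by positivity),
    ← ENNReal.ofReal_add (by positivity) hF] at h5
  exact (ENNReal.ofReal_le_ofReal_iff (by positivity)).1 h5

/-- If `c` has gained depth on `[a, b]`, then it gains a definite amount of depth on every long
stretch `[s, t]` before or after it: otherwise it pays off to transport part of the displacement
over `[a, b]` to `[s, t]`, translating the part of `c` in between. -/
theorem depth_ge_of_separated (hm : 0 < m) (hmf : ∀ x, m ≤ f x) (hM : ∀ x, f x ≤ M) (hF : 0 ≤ F)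
    {h : ℝ} (hh : 0 < h) (R : ℝ) :
    ∃ N : ℝ, 0 < N ∧ ∀ (c : ℝ → V) (I : Set ℝ), IsAlmostMaximalLift B e f F c I →
      ∀ a ∈ I, ∀ b ∈ I, ∀ s ∈ I, ∀ t ∈ I, a ≤ b → s ≤ t → ∀ k : V,
        (b ≤ s ∧ ((∀ x, f (x + k) = f x) ∨ b = s) ∨ t ≤ a ∧ ((∀ x, f (x + k) = f x) ∨ t = a)) →
        h ≤ S.depth k → 0 ≤ S.depth (c b - c a - k) → S.τ (c b - c a) ≤ R →
        N ≤ S.τ (c t - c s) → (m / (4 * M)) ^ 2 * h ≤ S.depth (c t - c s) := by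
  -- `2 * M * R` bounds the length lost on `[a, b]` (estimate with `r = 1`), `F` is the defect; the
  -- outer factor `2` is required by `depth_lower_bound`.
  obtain ⟨N, hN, hNC⟩ := exists_sqrt_threshold hm hh (2 * (2 * M * R + F))
  refine ⟨N, hN, fun c I hc a ha b hb s hs t ht hab hst k hcase hk hvk hR hNt => ?_⟩
  have hf : ∀ x, 0 < f x := fun x => hm.trans_le (hmf x)
  have hM0 : 0 < M := (hf 0).trans_le (hM 0)
  have hw := S.depth_nonneg he hc hs ht hst
  have hv := S.depth_nonneg he hc ha hb hab
  have hvτ := S.depth_le_τ (c b - c a)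
  obtain ⟨hwk, hsq⟩ := S.sqrt_le_of_depth hk hh.le hw
  have hR' : M * (1 * S.depth (c b - c a) + S.τ (c b - c a) / 1) ≤ 2 * M * R := by
    have := mul_le_mul_of_nonneg_left (by linarith :
      1 * S.depth (c b - c a) + S.τ (c b - c a) / 1 ≤ 2 * R) hM0.le
    linarith
  have hneg : (∀ x, f (x + k) = f x) → ∀ x, f (x + -k) = f x := fun hper x => by
    rw [← hper (x + -k)]; simp
  refine depth_lower_bound hm hM0 hh (hN.trans_le hNt) (hNC _ hNt) fun r hr => ?_
  rcases hcase with ⟨hbs, hper⟩ | ⟨hta, hper⟩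
  -- Competitor: straight to `c b - k`, along the translate by `-k` of the middle piece, then
  -- straight from `c s - k` to `c t`.
  · have r1 := S.reach_segment he hm.le hmf (c a) hvk
    have r2 : Reach B e f (c b - k) (c s - k) (curveLength B f c b s) := by
      simp only [sub_eq_add_neg]
      have r0 : Reach B e f (c b) (c s) (curveLength B f c b s) :=
        ⟨b, s, c, hbs, hc.causal.mono (hc.ordConnected.out hb hs), rfl, rfl, le_rfl⟩
      rcases hper with hper | rfl
      · exact r0.translate (hneg hper)
      · refine ⟨b, b, fun u => c u + -k, le_rfl, ?_, rfl, rfl, ?_⟩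
        · simpa using (hc.causal.mono (hc.ordConnected.out hb hb)).shift le_rfl 0 (-k)
        · simp [curveLength]
    have r3 := S.reach_segment he hm.le hmf (c s - k) hwk
    rw [show c a + (c b - c a - k) = c b - k by abel] at r1
    rw [show c s - k + (c t - c s + k) = c t by abel] at r3
    have r4 := (r1.trans r2).trans r3
    have r5 : Reach B e f (c a) (c t) (ENNReal.ofReal (m * Real.sqrt (S.depth (c t - c s + k) *
        S.τ (c t - c s + k))) + curveLength B f c b s) := by
      obtain ⟨x, y, z, z1, z2, z3, z4, z5⟩ := r4
      refine ⟨x, y, z, z1, z2, z3, z4, le_trans ?_ z5⟩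
      rw [add_comm]
      gcongr
      exact le_add_self
    have := S.le_of_reach he hf hM hF hc ha hb hs ht hab hbs hst one_pos hr r5
    have := mul_le_mul_of_nonneg_left hsq hm.le
    linarith
  · have r1 := S.reach_segment he hm.le hmf (c s) hwk
    have r2 : Reach B e f (c t + k) (c a + k) (curveLength B f c t a) := by
      have r0 : Reach B e f (c t) (c a) (curveLength B f c t a) :=
        ⟨t, a, c, hta, hc.causal.mono (hc.ordConnected.out ht ha), rfl, rfl, le_rfl⟩
      rcases hper with hper | rfl
      · exact r0.translate hper
      · refine ⟨t, t, fun u => c u + k, le_rfl, ?_, rfl, rfl, ?_⟩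
        · simpa using (hc.causal.mono (hc.ordConnected.out ht ht)).shift le_rfl 0 k
        · simp [curveLength]
    have r3 := S.reach_segment he hm.le hmf (c a + k) hvk
    rw [show c s + (c t - c s + k) = c t + k by abel] at r1
    rw [show c a + k + (c b - c a - k) = c b by abel] at r3
    have r4 := (r1.trans r2).trans r3
    have r5 : Reach B e f (c s) (c b) (ENNReal.ofReal (m * Real.sqrt (S.depth (c t - c s + k) *
        S.τ (c t - c s + k))) + curveLength B f c t a) := by
      obtain ⟨x, y, z, z1, z2, z3, z4, z5⟩ := r4
      exact ⟨x, y, z, z1, z2, z3, z4, le_self_add.trans z5⟩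
    have := S.le_of_reach he hf hM hF hc hs ht ha hb hst hta hab hr one_pos r5
    have := mul_le_mul_of_nonneg_left hsq hm.le
    linarith

/-- The depth of a compact piece of an almost maximal curve can be made arbitrarily large by
adjoining adjacent pieces, if the curve is long enough. -/
theorem exists_depth_ge (hm : 0 < m) (hmf : ∀ x, m ≤ f x) (hM : ∀ x, f x ≤ M) (hF : 0 ≤ F)
    {h : ℝ} (hh : 0 < h) (R : ℝ) (n : ℕ) :
    ∃ R' K : ℝ, ∀ (c : ℝ → V) (I : Set ℝ), IsAlmostMaximalLift B e f F c I →
      (∃ s ∈ I, ∃ t ∈ I, K ≤ S.τ (c t - c s)) →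
      (∃ a ∈ I, ∃ b ∈ I, a ≤ b ∧ h ≤ S.depth (c b - c a) ∧ S.τ (c b - c a) ≤ R) →
      ∃ a ∈ I, ∃ b ∈ I, a ≤ b ∧ h + n * ((m / (4 * M)) ^ 2 * h) ≤ S.depth (c b - c a) ∧
        S.τ (c b - c a) ≤ R' := by
  induction n with
  | zero => exact ⟨R, 0, fun c I hc _ h => by simpa using h⟩
  | succ n ih =>
    obtain ⟨R', K, ih⟩ := ih
    obtain ⟨N, hN, H⟩ := S.depth_ge_of_separated he hm hmf hM hF hh R'
    -- Total time `R' + 2 * N` leaves time at least `N` on one side of a piece of size at most `R'`.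
    refine ⟨R' + N, max K (R' + 2 * N), fun c I hc hK h0 => ?_⟩
    obtain ⟨s₀, hs₀, t₀, ht₀, hK⟩ := hK
    obtain ⟨a, ha, b, hb, hab, hd, hR⟩ :=
      ih c I hc ⟨s₀, hs₀, t₀, ht₀, (le_max_left _ _).trans hK⟩ h0
    have hK' := (le_max_right _ _).trans hK
    have hρ : 0 ≤ (m / (4 * M)) ^ 2 * h := by positivity
    have hh' : h ≤ S.depth (c b - c a) := by
      have : 0 ≤ (n : ℝ) * ((m / (4 * M)) ^ 2 * h) := by positivity
      linarith
    have hself : 0 ≤ S.depth (c b - c a - (c b - c a)) := by simp [S.depth_zero]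
    have hsplit : S.τ (c t₀ - c s₀) =
        S.τ (c t₀ - c b) + S.τ (c b - c a) + S.τ (c a - c s₀) := by
      simp only [map_sub]; ring
    by_cases hcase : N ≤ S.τ (c t₀ - c b)
    · have hbt : b ≤ t₀ := by
        by_contra hlt
        have := S.τ_nonneg he hc ht₀ hb (not_le.1 hlt).le
        rw [map_sub] at this hcase
        linarith
      obtain ⟨u, hu, huN⟩ := S.exists_mid hc hb ht₀ hbt hN.le hcase
      have huI := hc.ordConnected.out hb ht₀ hu
      -- The pieces are adjacent, so the whole displacement may serve as `k` without being a period.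
      have h1 := H c I hc a ha b hb b hb u huI hab hu.1 (c b - c a) (Or.inl ⟨le_rfl, Or.inr rfl⟩)
        hh' hself hR huN.ge
      have h2 := S.depth_add (c u - c b) (c b - c a)
      rw [sub_add_sub_cancel] at h2
      refine ⟨a, ha, u, huI, hab.trans hu.1, ?_, ?_⟩
      · push_cast; linarith
      · rw [map_sub] at huN hR ⊢; linarith
    · have hcase' : N ≤ S.τ (c a - c s₀) := by linarith
      have hsa : s₀ ≤ a := by
        by_contra hlt
        have := S.τ_nonneg he hc ha hs₀ (not_le.1 hlt).le
        rw [map_sub] at this hcase'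
        linarith
      obtain ⟨u, hu, huN⟩ := S.exists_mid hc hs₀ ha hsa (sub_nonneg.2 hcase') (by linarith)
      have huI := hc.ordConnected.out hs₀ ha hu
      have huN' : S.τ (c a - c u) = N := by
        simp only [map_sub] at huN ⊢; linarith
      have h1 := H c I hc a ha b hb u huI a ha hab hu.2 (c b - c a) (Or.inr ⟨le_rfl, Or.inr rfl⟩)
        hh' hself hR huN'.ge
      have h2 := S.depth_add (c b - c a) (c a - c u)
      rw [sub_add_sub_cancel] at h2
      refine ⟨u, huI, b, hb, hu.2.trans hab, ?_, ?_⟩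
      · push_cast; linarith
      · rw [map_sub] at huN' hR ⊢; linarith

/-- An almost maximal curve with a timelike piece has a piece of bounded size and definite
depth. -/
theorem exists_initial_piece (hm : 0 < m) (hmf : ∀ x, m ≤ f x) (hM : ∀ x, f x ≤ M) (hF : 0 ≤ F)
    {κ g : ℝ} (hκ : 0 < κ) (hg : 0 < g) :
    ∃ h R : ℝ, 0 < h ∧ ∀ (c : ℝ → V) (I : Set ℝ), IsAlmostMaximalLift B e f F c I →
      (∃ a ∈ I, ∃ b ∈ I, g ≤ S.τ (c b - c a) ∧ κ * S.τ (c b - c a) ≤ S.depth (c b - c a)) →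
      ∃ a ∈ I, ∃ b ∈ I, a ≤ b ∧ h ≤ S.depth (c b - c a) ∧ S.τ (c b - c a) ≤ R := by
  have hf : ∀ x, 0 < f x := fun x => hm.trans_le (hmf x)
  have hM0 : 0 < M := (hf 0).trans_le (hM 0)
  have hκ' : 0 < Real.sqrt κ := Real.sqrt_pos.2 hκ
  -- The straight segment has length at least `2 * q * τ`; half of this absorbs `F` once `τ ≥ F /
  -- q`.
  set q := m * Real.sqrt κ / 2 with hq
  have hq0 : 0 < q := by positivity
  set R := F / q + g with hRdef
  have hRg : g ≤ R := by
    have : 0 ≤ F / q := by positivity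
    linarith
  have hR0 : 0 < R := hg.trans_le hRg
  refine ⟨min (κ * g) (q ^ 2 * g / (4 * M ^ 2)), 2 * R, by positivity, fun c I hc hex => ?_⟩
  obtain ⟨a, ha, b, hb, hg', hκd⟩ := hex
  have hab : a ≤ b := by
    by_contra hlt
    have := S.τ_nonneg he hc hb ha (not_le.1 hlt).le
    rw [map_sub] at this hg'
    linarith
  have hτ0 : 0 < S.τ (c b - c a) := hg.trans_le hg'
  rcases le_total (S.τ (c b - c a)) R with hle | hle
  · exact ⟨a, ha, b, hb, hab, (min_le_left _ _).trans
      ((mul_le_mul_of_nonneg_left hg' hκ.le).trans hκd), by linarith⟩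
  have hlen : ENNReal.ofReal (q * S.τ (c b - c a)) ≤ curveLength B f c a b := by
    have h1 := (S.reach_segment he hm.le hmf (c a)
      (S.depth_nonneg he hc ha hb hab)).le_timeSep
    rw [add_sub_cancel] at h1
    have h2 := h1.trans (hc.timeSep_le a ha b hb hab)
    have h3 : q * S.τ (c b - c a) + F ≤
        m * Real.sqrt (S.depth (c b - c a) * S.τ (c b - c a)) := by
      have e1 : Real.sqrt κ * S.τ (c b - c a) ≤
          Real.sqrt (S.depth (c b - c a) * S.τ (c b - c a)) := by
        apply Real.le_sqrt_of_sq_le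
        rw [mul_pow, Real.sq_sqrt hκ.le, sq, ← mul_assoc]
        exact mul_le_mul_of_nonneg_right hκd hτ0.le
      have e2 : F ≤ q * S.τ (c b - c a) := by
        have : F / q ≤ S.τ (c b - c a) := by linarith
        rwa [div_le_iff₀' hq0] at this
      have e3 := mul_le_mul_of_nonneg_left e1 hm.le
      have e4 : m * (Real.sqrt κ * S.τ (c b - c a)) = 2 * (q * S.τ (c b - c a)) := by
        rw [hq]; ring
      linarith
    have h4 := (ENNReal.ofReal_le_ofReal h3).trans h2
    rw [ENNReal.ofReal_add (by positivity) hF] at h4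
    exact (ENNReal.add_le_add_iff_right ENNReal.ofReal_ne_top).1 h4
  obtain ⟨n, hn⟩ := pow_unbounded_of_one_lt (S.τ (c b - c a) / (2 * R)) one_lt_two
  obtain ⟨a', ha', b', hb', hab', h1, h2, h3⟩ := S.exists_bounded_piece hq0.le hR0.le hc n a ha b
    hb hab hle ((div_le_iff₀ (by positivity)).1 hn.le) hlen
  refine ⟨a', ha', b', hb', hab', (min_le_right _ _).trans ?_, h2⟩
  -- With `r = 2 * M / q` the time term is half of the lower bound `q * τ`; depth must account for
  -- the other half.
  have h4 := h3.trans (S.curveLength_le he hf hM hab' (hc.causal.mono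
    (hc.ordConnected.out ha' hb')) (r := 2 * M / q) (by positivity))
  have hd := S.depth_nonneg he hc ha' hb' hab'
  have hτ := hR0.le.trans h1
  have h5 := (ENNReal.ofReal_le_ofReal_iff (by positivity)).1 h4
  have h6 : M * (2 * M / q * S.depth (c b' - c a') + S.τ (c b' - c a') / (2 * M / q)) =
      2 * M ^ 2 * S.depth (c b' - c a') / q + q * S.τ (c b' - c a') / 2 := by
    field_simp
  rw [h6] at h5
  have h7 : q * S.τ (c b' - c a') / 2 ≤ 2 * M ^ 2 * S.depth (c b' - c a') / q := by linarith
  rw [le_div_iff₀ hq0] at h7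
  rw [div_le_iff₀ (by positivity)]
  have h8 := mul_le_mul_of_nonneg_left (hRg.trans h1) (sq_nonneg q)
  linarith

/-- Depth grows linearly if it grows on every piece of a fixed size. -/
theorem depth_ge_linear {N η : ℝ} (hN : 0 < N) (hη : 0 ≤ η)
    (hc : IsAlmostMaximalLift B e f F c I) (n : ℕ) :
    ∀ s ∈ I, ∀ t ∈ I, s ≤ t → S.τ (c t - c s) ≤ n * N →
      (∀ u ∈ Icc s t, ∀ u' ∈ Icc s t, u ≤ u' → N ≤ S.τ (c u' - c u) → η ≤ S.depth (c u' - c u)) →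
      η * (S.τ (c t - c s) / N - 1) ≤ S.depth (c t - c s) := by
  -- The `-1` pays for a leftover piece with time extent at most `N`.
  have hsmall : ∀ s ∈ I, ∀ t ∈ I, s ≤ t → S.τ (c t - c s) ≤ N →
      η * (S.τ (c t - c s) / N - 1) ≤ S.depth (c t - c s) := by
    intro s hs t ht hst hle
    refine le_trans ?_ (S.depth_nonneg he hc hs ht hst)
    have : S.τ (c t - c s) / N ≤ 1 := (div_le_one hN).2 hle
    exact mul_nonpos_of_nonneg_of_nonpos hη (by linarith)
  induction n with
  | zero =>
    intro s hs t ht hst hle _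
    exact hsmall s hs t ht hst (hle.trans (by simpa using hN.le))
  | succ n ih =>
    intro s hs t ht hst hle H
    rcases le_total (S.τ (c t - c s)) N with h | h
    · exact hsmall s hs t ht hst h
    obtain ⟨u, hu, huN⟩ := S.exists_mid hc hs ht hst hN.le h
    have huI := hc.ordConnected.out hs ht hu
    have hsum : S.τ (c t - c s) = S.τ (c t - c u) + N := by
      rw [← huN]; simp only [map_sub]; ring
    have h1 := ih u huI t ht hu.2 (by push_cast at hle; linarith) fun x hx y hy =>
      H x ⟨hu.1.trans hx.1, hx.2⟩ y ⟨hu.1.trans hy.1, hy.2⟩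
    have h2 := H s (left_mem_Icc.2 hst) u hu hu.1 huN.ge
    have h3 := S.depth_add (c t - c u) (c u - c s)
    rw [sub_add_sub_cancel] at h3
    have h4 : S.τ (c t - c s) / N = S.τ (c t - c u) / N + 1 := by
      rw [hsum]; field_simp
    rw [h4]
    linarith

end Splitting

/-! ### The lattice, and passage from the torus to lifts. -/

theorem exists_lattice_covering [FiniteDimensional ℝ V] (Γ : Submodule ℤ V) [DiscreteTopology Γ]
    [IsZLattice ℝ Γ] : ∃ r : ℝ, 0 ≤ r ∧ ∀ v : V, ∃ k ∈ Γ, ‖v - k‖ ≤ r := by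
  have : ProperSpace V := FiniteDimensional.proper ℝ V
  have := ZLattice.module_free ℝ Γ
  have := ZLattice.module_finite ℝ Γ
  let b := (Module.Free.chooseBasis ℤ Γ).ofZLatticeBasis ℝ Γ
  refine ⟨∑ i, ‖b i‖, by positivity, fun v => ⟨ZSpan.floor b v, ?_, ?_⟩⟩
  · exact (Module.Basis.ofZLatticeBasis_span ℝ Γ _).le (ZSpan.floor b v).2
  · rw [← ZSpan.fract_apply]
    exact ZSpan.norm_fract_le b v

theorem exists_bounds_of_periodic [FiniteDimensional ℝ V] (Γ : Submodule ℤ V) [DiscreteTopology Γ]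
    [IsZLattice ℝ Γ] (hf : Continuous f) (hf_pos : ∀ x, 0 < f x)
    (hf_per : ∀ x, ∀ k ∈ Γ, f (x + k) = f x) :
    ∃ m M : ℝ, 0 < m ∧ (∀ x, m ≤ f x) ∧ ∀ x, f x ≤ M := by
  have : ProperSpace V := FiniteDimensional.proper ℝ V
  obtain ⟨r, hr, hcov⟩ := exists_lattice_covering Γ
  have hne : (Metric.closedBall (0 : V) r).Nonempty := ⟨0, by simpa using hr⟩
  obtain ⟨x₀, -, h₀⟩ := (isCompact_closedBall (0 : V) r).exists_isMinOn hne hf.continuousOn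
  obtain ⟨x₁, -, h₁⟩ := (isCompact_closedBall (0 : V) r).exists_isMaxOn hne hf.continuousOn
  have hred : ∀ x, ∃ y ∈ Metric.closedBall (0 : V) r, f x = f y := by
    intro x
    obtain ⟨k, hk, hkr⟩ := hcov x
    exact ⟨x - k, by simpa using hkr, by rw [← hf_per (x - k) k hk, sub_add_cancel]⟩
  refine ⟨f x₀, f x₁, hf_pos _, fun x => ?_, fun x => ?_⟩
  · obtain ⟨y, hy, hxy⟩ := hred x
    rw [hxy]; exact h₀ hy
  · obtain ⟨y, hy, hxy⟩ := hred x
    rw [hxy]; exact h₁ hy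

/-- The curves are related only on `I`, so derivatives can be compared only in its interior; the
frontier of an interval is null. -/
theorem IsFutureCausal.congr_add {c c' : ℝ → V} (hI : I.OrdConnected) (h : IsFutureCausal B e c I)
    {k : V} (hk : ∀ t ∈ I, c' t = c t + k) : IsFutureCausal B e c' I := by
  have hae : ∀ᵐ t ∂volume.restrict I, t ∈ interior I := by
    rw [ae_restrict_iff' hI.measurableSet]
    have h0 : volume (frontier I) = 0 := hI.convex.addHaar_frontier volume
    filter_upwards [measure_eq_zero_iff_ae_notMem.1 h0] with t ht htI
    by_contra hint
    exact ht ⟨subset_closure htI, hint⟩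
  refine ⟨fun s hs t ht => ?_, ?_⟩
  · have h1 := h.1 s hs t ht
    have h2 : AbsolutelyContinuousOnInterval (fun u => c u + k) s t := by
      rw [absolutelyContinuousOnInterval_iff] at h1 ⊢
      simpa using h1
    exact AbsolutelyContinuousOnInterval.congr_of_eqOn h2
      fun u hu => (hk u (hI.uIcc_subset hs ht hu)).symm
  · filter_upwards [h.2, hae] with t ht hint
    have : c' =ᶠ[nhds t] fun u => c u + k :=
      Filter.eventually_of_mem (isOpen_interior.mem_nhds hint) fun u hu => hk u (interior_subset hu)
    rwa [this.deriv_eq, deriv_add_const]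

/-- Causality and almost maximality may be witnessed by different lifts, which differ by a constant.
`|F|` makes the defect nonnegative. -/
theorem IsAlmostMaximal.exists_lift {Γ : Submodule ℤ V} [DiscreteTopology Γ] {γ : ℝ → V ⧸ Γ}
    (hI : I.OrdConnected) (h : IsAlmostMaximal B e Γ f F γ I) :
    ∃ c, IsLift Γ γ I c ∧ IsAlmostMaximalLift B e f |F| c I := by
  obtain ⟨⟨c₀, hl₀, hc₀⟩, c, hl, hc⟩ := h
  refine ⟨c, hl, hI, ?_, fun s hs t ht hst => ?_⟩
  · rcases I.eq_empty_or_nonempty with rfl | ⟨u, hu⟩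
    · exact ⟨by simp, by simp⟩
    · exact hc₀.congr_add hI (k := c u - c₀ u) fun t ht => by
        rw [hl₀.sub_eq_sub hI hl hu ht]; abel
  · have h1 := hc s hs t ht hst
    rw [EReal.sub_le_iff_le_add (Or.inl (EReal.coe_ne_bot _)) (Or.inl (EReal.coe_ne_top _))] at h1
    rw [← EReal.coe_ennreal_le_coe_ennreal_iff, EReal.coe_ennreal_add, EReal.coe_ennreal_ofReal]
    refine h1.trans ?_
    gcongr
    exact_mod_cast (le_abs_self F).trans (le_max_left _ _)

/-- Almost maximal curves in `V` that contain a timelike piece of definite size gain depth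
linearly. -/
theorem Splitting.exists_depth_ratio [FiniteDimensional ℝ V] (S : Splitting B e) (he : B e e < 0)
    (Γ : Submodule ℤ V) [DiscreteTopology Γ] [IsZLattice ℝ Γ] (hm : 0 < m) (hmf : ∀ x, m ≤ f x)
    (hM : ∀ x, f x ≤ M) (hf_per : ∀ x, ∀ k ∈ Γ, f (x + k) = f x) (hF : 0 ≤ F)
    {κ g : ℝ} (hκ : 0 < κ) (hg : 0 < g) :
    ∃ κ' K : ℝ, 0 < κ' ∧ ∀ (c : ℝ → V) (I : Set ℝ), IsAlmostMaximalLift B e f F c I →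
      (∃ a ∈ I, ∃ b ∈ I, g ≤ S.τ (c b - c a) ∧ κ * S.τ (c b - c a) ≤ S.depth (c b - c a)) →
      ∀ s ∈ I, ∀ t ∈ I, s ≤ t → K ≤ S.τ (c t - c s) →
        κ' * S.τ (c t - c s) ≤ S.depth (c t - c s) := by
  have hM0 : 0 < M := (hm.trans_le (hmf 0)).trans_le (hM 0)
  obtain ⟨A, hA, -, hAd, -⟩ := S.exists_bounds
  obtain ⟨r, hr, hcov⟩ := exists_lattice_covering Γ
  obtain ⟨h, R₀, hh, H₀⟩ := S.exists_initial_piece he hm hmf hM hF hκ hg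
  -- After `n` enlargements, half of the displacement has depth at least `A * r + 1`. A lattice
  -- vector `k` within `r` of that half then has depth at least `1`, and the remainder has
  -- nonnegative depth.
  obtain ⟨n, hn⟩ := exists_nat_ge (2 * (A * r + 1) / ((m / (4 * M)) ^ 2 * h))
  rw [div_le_iff₀ (by positivity)] at hn
  obtain ⟨R, K, H₁⟩ := S.exists_depth_ge he hm hmf hM hF hh R₀ n
  obtain ⟨N, hN, H₂⟩ := S.depth_ge_of_separated he hm hmf hM hF one_pos R
  set η := (m / (4 * M)) ^ 2 * 1 with hηdef
  have hη : 0 < η := by positivity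
  -- At most `R` of the time is lost in the overlap with `[a, b]` and `N` on each side; beyond twice
  -- that, half survives.
  refine ⟨η / (2 * N), max K (2 * (R + 2 * N)), by positivity,
    fun c I hc hex s hs t ht hst hK => ?_⟩
  obtain ⟨a, ha, b, hb, hab, hd, hR⟩ :=
    H₁ c I hc ⟨s, hs, t, ht, (le_max_left _ _).trans hK⟩ (H₀ c I hc hex)
  obtain ⟨k, hkΓ, hkr⟩ := hcov ((1 / 2 : ℝ) • (c b - c a))
  have hhalf : A * r + 1 ≤ S.depth ((1 / 2 : ℝ) • (c b - c a)) := by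
    rw [S.depth_smul (by norm_num)]; linarith
  have hk1 : 1 ≤ S.depth k := by
    have e1 := S.depth_add ((1 / 2 : ℝ) • (c b - c a)) (k - (1 / 2 : ℝ) • (c b - c a))
    rw [add_sub_cancel] at e1
    have e2 := (abs_le.1 (hAd (k - (1 / 2 : ℝ) • (c b - c a)))).1
    rw [norm_sub_rev] at e2
    have := mul_le_mul_of_nonneg_left hkr hA.le
    linarith
  have hvk : 0 ≤ S.depth (c b - c a - k) := by
    have e1 := S.depth_add ((1 / 2 : ℝ) • (c b - c a)) ((1 / 2 : ℝ) • (c b - c a) - k)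
    rw [show (1 / 2 : ℝ) • (c b - c a) + ((1 / 2 : ℝ) • (c b - c a) - k) = c b - c a - k by
      rw [← add_sub_assoc, ← add_smul]; norm_num] at e1
    have e2 := (abs_le.1 (hAd ((1 / 2 : ℝ) • (c b - c a) - k))).1
    have := mul_le_mul_of_nonneg_left hkr hA.le
    linarith
  have hper : ∀ x, f (x + k) = f x := fun x => hf_per x k hkΓ
  have hside : ∀ x ∈ I, ∀ y ∈ I, x ≤ y → (y ≤ a ∨ b ≤ x ∨ x = y) →
      η * (S.τ (c y - c x) / N - 1) ≤ S.depth (c y - c x) := by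
    intro x hx y hy hxy hor
    obtain ⟨j, hj⟩ := exists_nat_ge (S.τ (c y - c x) / N)
    refine S.depth_ge_linear he hN hη.le hc j x hx y hy hxy ((div_le_iff₀ hN).1 hj) ?_
    intro u hu u' hu' huu hNu
    have huI := hc.ordConnected.out hx hy hu
    have huI' := hc.ordConnected.out hx hy hu'
    refine H₂ c I hc a ha b hb u huI u' huI' hab huu k ?_ hk1 hvk hR hNu
    rcases hor with hor | hor | rfl
    · exact Or.inr ⟨hu'.2.trans hor, Or.inl hper⟩
    · exact Or.inl ⟨hor.trans hu.1, Or.inl hper⟩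
    · exfalso
      have e1 : u = x := le_antisymm hu.2 hu.1
      have e2 : u' = x := le_antisymm hu'.2 hu'.1
      rw [e1, e2, sub_self, map_zero] at hNu
      linarith
  -- Cut `[s, t]` into the parts before, inside and after `[a, b]`; some may degenerate to points.
  obtain ⟨p, p', hsp, hpp, hpt, h1, h2, h3⟩ : ∃ p p', s ≤ p ∧ p ≤ p' ∧ p' ≤ t ∧
      (p ≤ a ∨ b ≤ s ∨ s = p) ∧ (t ≤ a ∨ b ≤ p' ∨ p' = t) ∧ (p = p' ∨ a ≤ p ∧ p' ≤ b) := by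
    rcases le_total b s with hbs | hbs
    · exact ⟨s, s, le_rfl, le_rfl, hst, by simp, Or.inr (Or.inl hbs), by simp⟩
    rcases le_total t a with hta | hta
    · exact ⟨t, t, hst, le_rfl, le_rfl, Or.inl hta, by simp, by simp⟩
    refine ⟨max s a, min b t, le_max_left _ _, max_le (le_min hbs hst) (le_min hab hta),
      min_le_right _ _, ?_, ?_, Or.inr ⟨le_max_right _ _, min_le_left _ _⟩⟩
    · rcases le_total s a with h | h <;> simp [h]
    · rcases le_total b t with h | h <;> simp [h]
  have hpI : p ∈ I := hc.ordConnected.out hs ht ⟨hsp, hpp.trans hpt⟩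
  have hpI' : p' ∈ I := hc.ordConnected.out hs ht ⟨hsp.trans hpp, hpt⟩
  have d1 := hside s hs p hpI hsp h1
  have d3 := hside p' hpI' t ht hpt h2
  have d2 := S.depth_nonneg he hc hpI hpI' hpp
  have hmid : S.τ (c p' - c p) ≤ R := by
    rcases h3 with rfl | ⟨hap, hpb⟩
    · rw [sub_self, map_zero]
      exact (S.τ_nonneg he hc ha hb hab).trans hR
    · have e1 := S.τ_nonneg he hc ha hpI hap
      have e2 := S.τ_nonneg he hc hpI' hb hpb
      simp only [map_sub] at e1 e2 hR ⊢
      linarith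
  have hdep : S.depth (c t - c p') + S.depth (c p' - c p) + S.depth (c p - c s) ≤
      S.depth (c t - c s) := by
    have e1 := S.depth_add (c t - c p') (c p' - c p)
    have e2 := S.depth_add (c t - c p) (c p - c s)
    rw [sub_add_sub_cancel] at e1 e2
    linarith
  have hτ : S.τ (c t - c s) = S.τ (c t - c p') + S.τ (c p' - c p) + S.τ (c p - c s) := by
    simp only [map_sub]; ring
  have hK' := (le_max_right _ _).trans hK
  have hfin : η / (2 * N) * S.τ (c t - c s) ≤
      η * (S.τ (c p - c s) / N - 1) + η * (S.τ (c t - c p') / N - 1) := by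
    have e1 : η * (S.τ (c p - c s) / N - 1) + η * (S.τ (c t - c p') / N - 1) =
        η / (2 * N) * (2 * (S.τ (c p - c s) + S.τ (c t - c p') - 2 * N)) := by
      field_simp
      ring
    rw [e1]
    exact mul_le_mul_of_nonneg_left (by linarith) (by positivity)
  linarith

end

end ConfTorus

end

theorem proposition2p1 {V : Type*} [NormedAddCommGroup V] [NormedSpace ℝ V]
    [FiniteDimensional ℝ V]
    (B : LinearMap.BilinForm ℝ V) (hB : ConfTorus.IsLorentzForm B)
    (e : V) (he : B e e < 0)
    (Γ : Submodule ℤ V) [DiscreteTopology Γ] [IsZLattice ℝ Γ]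
    (f : V → ℝ) (hf : ContDiff ℝ ∞ f) (hf_pos : ∀ x, 0 < f x)
    (hf_per : ∀ x, ∀ k ∈ Γ, f (x + k) = f x) :
    ∀ ε : ℝ, 0 < ε → ∀ F : ℝ, ∀ G₀ : ℝ, 0 < G₀ →
      ∃ δ : ℝ, 0 < δ ∧ ∃ K : ℝ, 0 < K ∧
        ∀ G : ℝ, G₀ ≤ G →
        ∀ (I : Set ℝ), I.OrdConnected → ∀ γ : ℝ → V ⧸ Γ,
          ConfTorus.IsTimelikeCurve B e Γ G ε γ I →
          ConfTorus.IsAlmostMaximal B e Γ f F γ I →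
          ∀ s ∈ I, ∀ t ∈ I, s < t → ∀ c : ℝ → V, ConfTorus.IsLift Γ γ I c →
            K ≤ ‖c t - c s‖ → c t - c s ∈ ConfTorus.strictCone B e δ := by
  intro ε hε F G₀ hG₀
  obtain ⟨S⟩ := hB.exists_splitting he
  obtain ⟨m, M, hm, hmf, hM⟩ :=
    ConfTorus.exists_bounds_of_periodic Γ hf.continuous hf_pos hf_per
  obtain ⟨A, hA, -, -, hAn⟩ := S.exists_bounds
  obtain ⟨κ, hκ, hκs⟩ := S.depth_ge_of_mem_strictCone he hε
  obtain ⟨κ', K, hκ', H⟩ := S.exists_depth_ratio he Γ hm hmf hM hf_per (abs_nonneg F) hκ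
    (g := G₀ / A) (by positivity)
  obtain ⟨δ, hδ, hδs⟩ := S.mem_strictCone_of_depth_ge he hκ'
  -- `A * K` forces time extent at least `K`; the `1` keeps the displacement nonzero.
  refine ⟨δ, hδ, max 1 (A * K), by positivity, ?_⟩
  intro G hG I hI γ hγt hγm s hs t ht hst c hc hK
  obtain ⟨c₁, hl₁, hc₁⟩ := hγm.exists_lift hI
  obtain ⟨-, c₂, hl₂, a, ha, b, hb, hab, habG⟩ := hγt
  have hdisp : c₂ b - c₂ a = c₁ b - c₁ a := by
    have := hl₁.sub_eq_sub hI hl₂ hb ha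
    rw [sub_eq_sub_iff_sub_eq_sub]
    exact this
  have hdisp' : c t - c s = c₁ t - c₁ s := by
    have := hl₁.sub_eq_sub hI hc ht hs
    rw [sub_eq_sub_iff_sub_eq_sub]
    exact this
  rw [hdisp] at hab habG
  rw [hdisp'] at hK ⊢
  have hd := S.depth_nonneg he hc₁ hs ht hst.le
  have hn : 0 < ‖c₁ t - c₁ s‖ := one_pos.trans_le ((le_max_left _ _).trans hK)
  refine hδs _ (norm_pos_iff.1 hn) hd ?_
  refine H c₁ I hc₁ ⟨a, ha, b, hb, ?_, hκs _ hab⟩ s hs t ht hst.le ?_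
  · rw [div_le_iff₀' hA]
    exact (hG.trans habG).trans (hAn _ ((S.mem_futureCone_iff he _).1 hab.1).2)
  · have := ((le_max_right _ _).trans hK).trans (hAn _ hd)
    exact le_of_mul_le_mul_left this hA
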